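/- Let $A_0,A_1,B_0,B_1,R,S$ be finite-dimensional non-zero complex Hilbert spaces (with fixed orthonormal bases) such that $\dim R=\dim A_1$ and $\dim S=\dim B_1$. A quantum channel is a completely positive trace-preserving linear map. A channel $\mathcal E$ from operators on $A_0\otimes B_0$ to operators on $A_1\otimes B_1$ is called LOSR if $\mathcal E=\sum_\lambda p_\lambda\,\mathcal E_A^\lambda\otimes\mathcal E_B^\lambda$ (finite sum) with $p_\lambda\ge 0$, $\sum_\lambda p_\lambda=1$ and quantum channels $\mathcal E_A^\lambda$ from $A_0$ to $A_1$ and $\mathcal E_B^\lambda$ from $B_0$ to $B_1$. Fix density matrices $(\rho^x)_{x\in X}$ on $R\otimes A_0$ and $(\sigma^y)_{y\in Y}$ on $S\otimes B_0$, each family being linearly independent and spanning the space of all linear operators on $R\otimes A_0$, respectively $S\otimes B_0$. Let $(\Psi^a)_a$ and $(\Phi^b)_b$ be the projective measurements in generalized Bell bases of $R\otimes A_1$ and $S\otimes B_1$, i.e. $\Psi^a=|\psi_a\rangle\langle\psi_a|$, $\Phi^b=|\varphi_b\rangle\langle\varphi_b|$ for orthonormal bases $(\psi_a)$, $(\varphi_b)$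 consisting of maximally entangled vectors (both reduced states are maximally mixed). For a channel $\mathcal E$ from $A_0\otimes B_0$ to $A_1\otimes B_1$ and measurements (POVMs) $M=(M^a)_a$ on $R\otimes A_1$, $N=(N^b)_b$ on $S\otimes B_1$ put $$p_{\mathcal E,M,N}(ab|xy)=\mathrm{Tr}\big((M^a\otimes N^b)\,(\mathcal E\otimes\mathrm{id}_{RS})[\rho^x\otimes\sigma^y]\big),\qquad p_{\mathcal E}:=p_{\mathcal E,\Psi,\Phi}.$$ For a real linear functional $\gamma(p)=\sum_{ab,xy}\gamma_{ab,xy}\,p(ab|xy)$ put $$\gamma_{\mathrm{loc}}=\max_{\tilde M,\tilde N}\ \sum_{ab,xy}\gamma_{ab,xy}\,\mathrm{Tr}(\tilde M^a\rho^x)\,\mathrm{Tr}(\tilde N^b\sigma^y),$$ where $\tilde M=(\tilde M^a)_a$ and $\tilde N=(\tilde N^b)_b$ range over all POVMs on $R\otimes A_0$ and $S\otimes B_0$. Then: (1) the maximum $\gamma_{\mathrm{loc}}$ exists for every $\gamma$; (2) a quantum channel $\mathcal E$ from $A_0\otimes B_0$ to $A_1\otimes B_1$ is not LOSR if and only if $\gamma(p_{\mathcal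 E})>\gamma_{\mathrm{loc}}$ for some $\gamma$; (3) (measurement-device independence) for every $\gamma$, every LOSR channel $\mathcal E$ and all POVMs $M=(M^a)_a$, $N=(N^b)_b$ on $R\otimes A_1$ and $S\otimes B_1$, one has $\gamma(p_{\mathcal E,M,N})\le\gamma_{\mathrm{loc}}$. -/

import Mathlib

open scoped Matrix Kronecker ComplexOrder

namespace LOSRWitness

/-- A density matrix on `ℂⁿ`: positive semidefinite with unit trace. -/
def IsState {n : Type*} [Fintype n] (ρ : Matrix n n ℂ) : Prop :=
  ρ.PosSemidef ∧ ρ.trace = 1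

/-- A measurement (POVM) on `ℂⁿ` with outcomes in `α`. -/
def IsPOVM {n α : Type*} [DecidableEq n] [Fintype α] (M : α → Matrix n n ℂ) : Prop :=
  (∀ a, (M a).PosSemidef) ∧ ∑ a, M a = 1

/-- The tensor product `Φ ⊗ Ψ` of two linear maps between matrix algebras: the linear map with
`(Φ ⊗ Ψ)(X ⊗ Y) = Φ(X) ⊗ Ψ(Y)` (see `tensorMap_kronecker`), written out on matrix units. -/
noncomputable def tensorMap {n₀ n₁ m₀ m₁ : Type*} [Fintype n₀] [DecidableEq n₀] [Fintype m₀]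
    [DecidableEq m₀] (Φ : Matrix n₀ n₀ ℂ →ₗ[ℂ] Matrix n₁ n₁ ℂ)
    (Ψ : Matrix m₀ m₀ ℂ →ₗ[ℂ] Matrix m₁ m₁ ℂ) :
    Matrix (n₀ × m₀) (n₀ × m₀) ℂ →ₗ[ℂ] Matrix (n₁ × m₁) (n₁ × m₁) ℂ where
  toFun X := ∑ i, ∑ j, ∑ k, ∑ l,
    X (i, k) (j, l) • (Φ (Matrix.single i j 1) ⊗ₖ Ψ (Matrix.single k l 1))
  map_add' X Y := by simp only [Matrix.add_apply, add_smul, Finset.sum_add_distrib]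
  map_smul' c X := by
    simp only [Matrix.smul_apply, smul_assoc, Finset.smul_sum, RingHom.id_apply]

theorem tensorMap_kronecker {n₀ n₁ m₀ m₁ : Type*} [Fintype n₀] [DecidableEq n₀] [Fintype m₀]
    [DecidableEq m₀] (Φ : Matrix n₀ n₀ ℂ →ₗ[ℂ] Matrix n₁ n₁ ℂ)
    (Ψ : Matrix m₀ m₀ ℂ →ₗ[ℂ] Matrix m₁ m₁ ℂ) (X : Matrix n₀ n₀ ℂ) (Y : Matrix m₀ m₀ ℂ) :
    tensorMap Φ Ψ (X ⊗ₖ Y) = Φ X ⊗ₖ Ψ Y := by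
  have hX : Φ X = ∑ i, ∑ j, X i j • Φ (Matrix.single i j 1) := by
    conv_lhs => rw [Matrix.matrix_eq_sum_single X]
    simp only [map_sum, ← map_smul, Matrix.smul_single, smul_eq_mul, mul_one]
  have hY : Ψ Y = ∑ k, ∑ l, Y k l • Ψ (Matrix.single k l 1) := by
    conv_lhs => rw [Matrix.matrix_eq_sum_single Y]
    simp only [map_sum, ← map_smul, Matrix.smul_single, smul_eq_mul, mul_one]
  ext p q
  rw [hX, hY]
  simp only [tensorMap, LinearMap.coe_mk, AddHom.coe_mk, Matrix.sum_apply, Matrix.smul_apply,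
    Matrix.kroneckerMap_apply, smul_eq_mul]
  rw [Finset.sum_mul]
  refine Finset.sum_congr rfl fun i _ => ?_
  rw [Finset.sum_mul]
  refine Finset.sum_congr rfl fun j _ => ?_
  rw [Finset.mul_sum]
  refine Finset.sum_congr rfl fun k _ => ?_
  rw [Finset.mul_sum]
  refine Finset.sum_congr rfl fun l _ => ?_
  ring

/-- Complete positivity: `id_k ⊗ Φ` maps positive semidefinite matrices to positive semidefinite
matrices, for every ancilla dimension `k`. -/
def IsCompletelyPositive {n m : Type*} [Fintype n] [DecidableEq n]
    (Φ : Matrix n n ℂ →ₗ[ℂ] Matrix m m ℂ) : Prop :=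
  ∀ (k : ℕ) (X : Matrix (Fin k × n) (Fin k × n) ℂ), X.PosSemidef →
    (tensorMap (LinearMap.id : Matrix (Fin k) (Fin k) ℂ →ₗ[ℂ] Matrix (Fin k) (Fin k) ℂ)
      Φ X).PosSemidef

/-- A quantum channel: a completely positive, trace preserving linear map. -/
def IsChannel {n m : Type*} [Fintype n] [DecidableEq n] [Fintype m]
    (Φ : Matrix n n ℂ →ₗ[ℂ] Matrix m m ℂ) : Prop :=
  IsCompletelyPositive Φ ∧ ∀ X, (Φ X).trace = X.trace

/-- Local operations assisted by shared randomness: convex combinations of tensor products of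
quantum channels. -/
def IsLOSR {A₀ A₁ B₀ B₁ : Type*} [Fintype A₀] [DecidableEq A₀] [Fintype A₁]
    [Fintype B₀] [DecidableEq B₀] [Fintype B₁]
    (E : Matrix (A₀ × B₀) (A₀ × B₀) ℂ →ₗ[ℂ] Matrix (A₁ × B₁) (A₁ × B₁) ℂ) : Prop :=
  ∃ (n : ℕ) (p : Fin n → ℝ) (EA : Fin n → (Matrix A₀ A₀ ℂ →ₗ[ℂ] Matrix A₁ A₁ ℂ))
    (EB : Fin n → (Matrix B₀ B₀ ℂ →ₗ[ℂ] Matrix B₁ B₁ ℂ)),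
    (∀ i, 0 ≤ p i) ∧ ∑ i, p i = 1 ∧ (∀ i, IsChannel (EA i)) ∧ (∀ i, IsChannel (EB i)) ∧
      E = ∑ i, (p i : ℂ) • tensorMap (EA i) (EB i)

/-- Reordering of tensor factors, `RA ⊗ SB ≃ AB ⊗ RS`. -/
def shuffle (R A S B : Type*) : (R × A) × (S × B) ≃ (A × B) × (R × S) where
  toFun t := ((t.1.2, t.2.2), (t.1.1, t.2.1))
  invFun t := ((t.2.1, t.1.1), (t.2.2, t.1.2))
  left_inv _ := rfl
  right_inv _ := rfl

/-- The map `E_{AB} ⊗ id_{RS}`, acting on matrices over the ordering `RA₀ ⊗ SB₀` of the input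
factors and returning matrices over the ordering `RA₁ ⊗ SB₁` of the output factors. -/
noncomputable def extend {A₀ A₁ B₀ B₁ : Type*} (R S : Type*) [Fintype A₀] [DecidableEq A₀]
    [Fintype B₀] [DecidableEq B₀] [Fintype R] [DecidableEq R] [Fintype S] [DecidableEq S]
    (E : Matrix (A₀ × B₀) (A₀ × B₀) ℂ →ₗ[ℂ] Matrix (A₁ × B₁) (A₁ × B₁) ℂ)
    (X : Matrix ((R × A₀) × (S × B₀)) ((R × A₀) × (S × B₀)) ℂ) :
    Matrix ((R × A₁) × (S × B₁)) ((R × A₁) × (S × B₁)) ℂ :=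
  Matrix.reindex (shuffle R A₁ S B₁).symm (shuffle R A₁ S B₁).symm
    (tensorMap E (LinearMap.id : Matrix (R × S) (R × S) ℂ →ₗ[ℂ] Matrix (R × S) (R × S) ℂ)
      (Matrix.reindex (shuffle R A₀ S B₀) (shuffle R A₀ S B₀) X))

/-- The distribution `p(a,b|x,y) = Tr((Mᵃ ⊗ Nᵇ) (E_{AB} ⊗ id_{RS})[ρˣ ⊗ σʸ])`. -/
noncomputable def behaviour {A₀ A₁ B₀ B₁ R S X Y α β : Type*} [Fintype A₀] [DecidableEq A₀]
    [Fintype A₁] [Fintype B₀] [DecidableEq B₀] [Fintype B₁] [Fintype R] [DecidableEq R]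
    [Fintype S] [DecidableEq S]
    (E : Matrix (A₀ × B₀) (A₀ × B₀) ℂ →ₗ[ℂ] Matrix (A₁ × B₁) (A₁ × B₁) ℂ)
    (ρ : X → Matrix (R × A₀) (R × A₀) ℂ) (σ : Y → Matrix (S × B₀) (S × B₀) ℂ)
    (M : α → Matrix (R × A₁) (R × A₁) ℂ) (N : β → Matrix (S × B₁) (S × B₁) ℂ)
    (a : α) (b : β) (x : X) (y : Y) : ℝ :=
  (((M a ⊗ₖ N b) * extend R S E (ρ x ⊗ₖ σ y)).trace).re

/-- The value `γ(p) = ∑ γ_{ab,xy} p(ab|xy)` of the linear functional with coefficients `γ`. -/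
def value {X Y α β : Type*} [Fintype X] [Fintype Y] [Fintype α] [Fintype β]
    (γ p : α → β → X → Y → ℝ) : ℝ :=
  ∑ a, ∑ b, ∑ x, ∑ y, γ a b x y * p a b x y

/-- All values `∑ γ_{ab,xy} Tr(Mᵃ ρˣ) Tr(Nᵇ σʸ)`, for measurements `M`, `N` on the two input
spaces. -/
def localValues {m n X Y α β : Type*} [Fintype m] [DecidableEq m] [Fintype n] [DecidableEq n]
    [Fintype X] [Fintype Y] [Fintype α] [Fintype β]
    (ρ : X → Matrix m m ℂ) (σ : Y → Matrix n n ℂ) (γ : α → β → X → Y → ℝ) : Set ℝ :=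
  {v | ∃ (M : α → Matrix m m ℂ) (N : β → Matrix n n ℂ), IsPOVM M ∧ IsPOVM N ∧
    v = value γ fun a b x y => ((M a * ρ x).trace).re * ((N b * σ y).trace).re}

/-- The supremum of `localValues`; that it is an attained maximum is part of the theorem. -/
noncomputable def localMax {m n X Y α β : Type*} [Fintype m] [DecidableEq m] [Fintype n]
    [DecidableEq n] [Fintype X] [Fintype Y] [Fintype α] [Fintype β]
    (ρ : X → Matrix m m ℂ) (σ : Y → Matrix n n ℂ) (γ : α → β → X → Y → ℝ) : ℝ :=
  sSup (localValues ρ σ γ)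

/-- The rank-one matrix `|ψ⟩⟨ψ|`. -/
def ketbra {n : Type*} (ψ : EuclideanSpace ℂ n) : Matrix n n ℂ :=
  Matrix.of fun i j => ψ i * star (ψ j)

/-- Partial trace over the first factor. -/
def traceFst {m n : Type*} [Fintype m] (X : Matrix (m × n) (m × n) ℂ) : Matrix n n ℂ :=
  Matrix.of fun i j => ∑ r, X (r, i) (r, j)

/-- Partial trace over the second factor. -/
def traceSnd {m n : Type*} [Fintype n] (X : Matrix (m × n) (m × n) ℂ) : Matrix m m ℂ :=
  Matrix.of fun r s => ∑ i, X (r, i) (s, i)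

/-- A generalized Bell basis of `ℂᴿ ⊗ ℂᴬ`: an orthonormal basis all of whose members are maximally
entangled, that is, both reduced states of each member are maximally mixed. Such a basis exists
only if the two factors have the same dimension `d`. An example, for `d` given, is
`φ_{ab} = d^{-1/2} ∑ₖ exp(2πi b k / d) |k, k + a⟩`. -/
def IsBellBasis {R A α : Type*} [Fintype R] [DecidableEq R] [Fintype A] [DecidableEq A]
    [Fintype α] (ψ : OrthonormalBasis α ℂ (EuclideanSpace ℂ (R × A))) : Prop :=
  ∀ a, traceFst (ketbra (ψ a)) = (1 / (Fintype.card A : ℂ)) • (1 : Matrix A A ℂ) ∧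
    traceSnd (ketbra (ψ a)) = (1 / (Fintype.card R : ℂ)) • (1 : Matrix R R ℂ)

/-- The projective measurement in an orthonormal basis. -/
noncomputable def basisMeasurement {n α : Type*} [Fintype n] [Fintype α]
    (ψ : OrthonormalBasis α ℂ (EuclideanSpace ℂ n)) (a : α) : Matrix n n ℂ :=
  ketbra (ψ a)

end LOSRWitness

/-!
By the trace pairing, a measurement performed after a channel is a measurement performed before it.
Hence the behaviour of an LOSR channel is a convex combination of local behaviours
`Tr(Mᵃ ρˣ) Tr(Nᵇ σʸ)`, whatever the measurements are. The local behaviours form a compact set,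
whose convex hull is compact in finite dimensions, so every functional attains its maximum on it
and by Hahn-Banach a behaviour lies outside the hull if and only if some functional exceeds that
maximum.

Conversely, suppose that the behaviour of `E` under Bell measurements lies in the hull. The inputs
span, so the decomposition into local terms extends from the inputs to all operators. Let now both
parties teleport the outputs of `E`, with Bell states as resources and Bell measurements: this does
not change `E`. In the decomposition, the Bell measurements are replaced by the local measurements
on `R ⊗ A₀` and `S ⊗ B₀`, and teleportation with such a measurement is a channel from `A₀` to `A₁`,
respectively from `B₀` to `B₁`. So `E` is a convex combination of products of channels.
-/

namespace LOSRWitness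

section Matrices

theorem kronecker_induction {l m n p R : Type*} [Finite l] [Finite m] [Finite n] [Finite p]
    [Semiring R] {P : Matrix (l × n) (m × p) R → Prop}
    (kronecker : ∀ (X : Matrix l m R) (Y : Matrix n p R), P (X ⊗ₖ Y))
    (add : ∀ M N, P M → P N → P (M + N)) (M : Matrix (l × n) (m × p) R) : P M := by
  classical
  refine Matrix.induction_on' M ?_ add fun i j x => ?_
  · simpa only [Matrix.zero_kronecker] using kronecker 0 0
  · simpa only [Matrix.single_kronecker_single, mul_one] using
      kronecker (Matrix.single i.1 j.1 x) (Matrix.single i.2 j.2 1)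

variable {n : Type*} [Fintype n]

theorem ofReal_re_trace_mul {M N : Matrix n n ℂ} (hM : M.IsHermitian) (hN : N.IsHermitian) :
    ((M * N).trace.re : ℂ) = (M * N).trace := by
  rw [← Complex.conj_eq_iff_re, starRingEnd_apply, ← Matrix.trace_conjTranspose,
    Matrix.conjTranspose_mul, hM.eq, hN.eq, Matrix.trace_mul_comm]

theorem isHermitian_kronecker {m n R : Type*} [CommSemiring R] [StarRing R] {M : Matrix m m R}
    {N : Matrix n n R} (hM : M.IsHermitian) (hN : N.IsHermitian) : (M ⊗ₖ N).IsHermitian := by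
  rw [Matrix.IsHermitian, Matrix.conjTranspose_kronecker, hM.eq, hN.eq]

theorem trace_mul_vecMulVec {R : Type*} [CommSemiring R] (M : Matrix n n R) (v w : n → R) :
    (M * Matrix.vecMulVec v w).trace = w ⬝ᵥ (M *ᵥ v) := by
  rw [Matrix.mul_vecMulVec, Matrix.trace_vecMulVec, dotProduct_comm]

theorem trace_mul_nonneg {𝕜 : Type*} [RCLike 𝕜] {M N : Matrix n n 𝕜} (hM : M.PosSemidef)
    (hN : N.PosSemidef) : 0 ≤ (M * N).trace := by
  obtain ⟨k, v, rfl⟩ := Matrix.posSemidef_iff_eq_sum_vecMulVec.1 hN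
  rw [Finset.mul_sum, Matrix.trace_sum]
  refine Finset.sum_nonneg fun i _ => ?_
  rw [trace_mul_vecMulVec]
  exact hM.dotProduct_mulVec_nonneg (v i)

theorem posSemidef_of_trace_mul_nonneg {M : Matrix n n ℂ}
    (h : ∀ X : Matrix n n ℂ, X.PosSemidef → 0 ≤ (M * X).trace) : M.PosSemidef := by
  classical
  rw [← Matrix.isPositive_toEuclideanLin_iff, LinearMap.isPositive_iff_complex]
  intro v
  have hv : 0 ≤ inner ℂ (M.toEuclideanLin v) v := by
    have hMv := h _ (Matrix.posSemidef_vecMulVec_self_star v.ofLp)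
    rw [trace_mul_vecMulVec] at hMv
    rw [← inner_conj_symm, EuclideanSpace.inner_eq_star_dotProduct, dotProduct_comm]
    exact star_nonneg_iff.2 hMv
  exact ⟨(Complex.eq_re_of_ofReal_le (r := 0) (by simpa using hv)).symm, (Complex.le_def.1 hv).1⟩

end Matrices

section LinearMaps

variable {n n₁ m m₁ κ : Type*} [Fintype n] [DecidableEq n] [Fintype m] [DecidableEq m]
  [Fintype κ] [DecidableEq κ]

theorem tensorMap_id_id :
    tensorMap (LinearMap.id : Matrix n n ℂ →ₗ[ℂ] Matrix n n ℂ)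
      (LinearMap.id : Matrix m m ℂ →ₗ[ℂ] Matrix m m ℂ) = LinearMap.id := by
  refine LinearMap.ext fun M => ?_
  induction M using kronecker_induction with
  | kronecker X Y => exact tensorMap_kronecker _ _ X Y
  | add M N hM hN => rw [map_add, map_add, hM, hN]

theorem tensorMap_add_left (Φ Φ' : Matrix n n ℂ →ₗ[ℂ] Matrix n₁ n₁ ℂ)
    (Ψ : Matrix m m ℂ →ₗ[ℂ] Matrix m₁ m₁ ℂ) :
    tensorMap (Φ + Φ') Ψ = tensorMap Φ Ψ + tensorMap Φ' Ψ := by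
  refine LinearMap.ext fun M => ?_
  induction M using kronecker_induction with
  | kronecker X Y =>
    simp only [LinearMap.add_apply, tensorMap_kronecker, Matrix.add_kronecker]
  | add M N hM hN => rw [map_add, map_add, hM, hN]

theorem tensorMap_smul_left (c : ℂ) (Φ : Matrix n n ℂ →ₗ[ℂ] Matrix n₁ n₁ ℂ)
    (Ψ : Matrix m m ℂ →ₗ[ℂ] Matrix m₁ m₁ ℂ) : tensorMap (c • Φ) Ψ = c • tensorMap Φ Ψ := by
  refine LinearMap.ext fun M => ?_
  induction M using kronecker_induction with
  | kronecker X Y =>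
    simp only [LinearMap.smul_apply, tensorMap_kronecker, Matrix.smul_kronecker]
  | add M N hM hN => rw [map_add, map_add, hM, hN]

/-- A linear map of matrix algebras that commutes with the adjoint, so that it maps Hermitian
matrices to Hermitian matrices. -/
def IsHermitianPreserving {n m : Type*} (Φ : Matrix n n ℂ →ₗ[ℂ] Matrix m m ℂ) : Prop :=
  ∀ X, Φ Xᴴ = (Φ X)ᴴ

theorem isHermitianPreserving_id {n : Type*} :
    IsHermitianPreserving (LinearMap.id : Matrix n n ℂ →ₗ[ℂ] Matrix n n ℂ) :=
  fun _ => rfl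

theorem IsHermitianPreserving.isHermitian_apply {n m : Type*}
    {Φ : Matrix n n ℂ →ₗ[ℂ] Matrix m m ℂ} (hΦ : IsHermitianPreserving Φ)
    {X : Matrix n n ℂ} (hX : X.IsHermitian) : (Φ X).IsHermitian := by
  rw [Matrix.IsHermitian, ← hΦ, hX.eq]

theorem IsHermitianPreserving.tensorMap {Φ : Matrix n n ℂ →ₗ[ℂ] Matrix n₁ n₁ ℂ}
    {Ψ : Matrix m m ℂ →ₗ[ℂ] Matrix m₁ m₁ ℂ} (hΦ : IsHermitianPreserving Φ)
    (hΨ : IsHermitianPreserving Ψ) : IsHermitianPreserving (tensorMap Φ Ψ) := by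
  intro M
  induction M using kronecker_induction with
  | kronecker X Y =>
    simp only [Matrix.conjTranspose_kronecker, tensorMap_kronecker, hΦ X, hΨ Y]
  | add M N hM hN => simp only [Matrix.conjTranspose_add, map_add, hM, hN]

theorem tensorMap_id_left_apply (Φ : Matrix n n ℂ →ₗ[ℂ] Matrix n₁ n₁ ℂ)
    (M : Matrix (κ × n) (κ × n) ℂ) (p q : κ × n₁) :
    tensorMap (LinearMap.id : Matrix κ κ ℂ →ₗ[ℂ] Matrix κ κ ℂ) Φ M p q =
      Φ (M.submatrix (Prod.mk p.1) (Prod.mk q.1)) p.2 q.2 := by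
  induction M using kronecker_induction with
  | kronecker X Y =>
    have hXY : (X ⊗ₖ Y).submatrix (Prod.mk p.1) (Prod.mk q.1) = X p.1 q.1 • Y := rfl
    rw [tensorMap_kronecker, hXY, map_smul]
    rfl
  | add M N hM hN =>
    rw [map_add, Matrix.add_apply, hM, hN, Matrix.submatrix_add, Pi.add_apply, Pi.add_apply,
      map_add, Matrix.add_apply]

theorem trace_tensorMap_id_left [Fintype n₁]
    {Φ : Matrix n n ℂ →ₗ[ℂ] Matrix n₁ n₁ ℂ}
    (hΦ : ∀ X, (Φ X).trace = X.trace) (M : Matrix (κ × n) (κ × n) ℂ) :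
    (tensorMap (LinearMap.id : Matrix κ κ ℂ →ₗ[ℂ] Matrix κ κ ℂ) Φ M).trace = M.trace := by
  induction M using kronecker_induction with
  | kronecker X Y =>
    rw [tensorMap_kronecker, Matrix.trace_kronecker, Matrix.trace_kronecker, hΦ, LinearMap.id_apply]
  | add M N hM hN => rw [map_add, Matrix.trace_add, Matrix.trace_add, hM, hN]

theorem IsCompletelyPositive.tensorMap_id_left {Φ : Matrix n n ℂ →ₗ[ℂ] Matrix n₁ n₁ ℂ}
    (hΦ : IsCompletelyPositive Φ) {X : Matrix (κ × n) (κ × n) ℂ} (hX : X.PosSemidef) :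
    (tensorMap (LinearMap.id : Matrix κ κ ℂ →ₗ[ℂ] Matrix κ κ ℂ) Φ X).PosSemidef := by
  let e := Fintype.equivFin κ
  convert (hΦ _ _ (hX.submatrix (Prod.map e.symm id))).submatrix (Prod.map e id) using 1
  ext p q
  simp [tensorMap_id_left_apply, Matrix.submatrix_submatrix, Function.comp_def]

/-- The argument is the Choi matrix: `∑ᵢⱼ |i⟩⟨j| ⊗ Φ(|i⟩⟨j|)` is the image of a positive
semidefinite matrix. -/
theorem IsCompletelyPositive.isHermitianPreserving {Φ : Matrix n n ℂ →ₗ[ℂ] Matrix n₁ n₁ ℂ}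
    (hΦ : IsCompletelyPositive Φ) : IsHermitianPreserving Φ := by
  let w : n × n → ℂ := fun p => (1 : Matrix n n ℂ) p.1 p.2
  have hblock (i j : n) : (Matrix.vecMulVec w (star w)).submatrix (Prod.mk i) (Prod.mk j) =
      Matrix.single i j 1 := by
    rw [Matrix.single_eq_single_vecMulVec_single]
    ext k l
    simp [w, Matrix.vecMulVec_apply, Matrix.one_apply, Pi.single_apply, eq_comm]
  have hsingle (i j : n) : Φ (Matrix.single j i 1) = (Φ (Matrix.single i j 1))ᴴ := by
    ext k l
    have hChoi := (hΦ.tensorMap_id_left (Matrix.posSemidef_vecMulVec_self_star w)).isHermitian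
    simpa only [Matrix.conjTranspose_apply, tensorMap_id_left_apply, hblock] using
      (hChoi.apply (j, k) (i, l)).symm
  intro X
  induction X using Matrix.induction_on' with
  | h_zero => simp only [Matrix.conjTranspose_zero, map_zero]
  | h_add X Y hX hY => simp only [Matrix.conjTranspose_add, map_add, hX, hY]
  | h_std_basis i j c =>
    rw [Matrix.conjTranspose_single, ← mul_one c, star_mul', star_one, ← smul_eq_mul,
      ← smul_eq_mul, ← Matrix.smul_single, ← Matrix.smul_single, map_smul, map_smul, hsingle i j,
      Matrix.conjTranspose_smul]

theorem isCompletelyPositive_of_kraus {ι : Type*} [Fintype ι] [Finite n₁]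
    {Φ : Matrix n n ℂ →ₗ[ℂ] Matrix n₁ n₁ ℂ} (K : ι → Matrix n₁ n ℂ)
    (hΦ : ∀ X, Φ X = ∑ i, K i * X * (K i)ᴴ) : IsCompletelyPositive Φ := by
  intro k M hM
  let L (i : ι) : Matrix (Fin k × n₁) (Fin k × n) ℂ := (1 : Matrix (Fin k) (Fin k) ℂ) ⊗ₖ K i
  have hL (M : Matrix (Fin k × n) (Fin k × n) ℂ) :
      tensorMap LinearMap.id Φ M = ∑ i, L i * M * (L i)ᴴ := by
    induction M using kronecker_induction with
    | kronecker X Y =>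
      simp only [L, tensorMap_kronecker, hΦ, Matrix.conjTranspose_kronecker,
        ← Matrix.mul_kronecker_mul, Matrix.conjTranspose_one, Matrix.one_mul, Matrix.mul_one,
        LinearMap.id_apply]
      exact map_sum (Matrix.kroneckerBilinear (R := ℂ) (n := n₁) (p := n₁) X) _ _
    | add M N hM hN =>
      simp only [map_add, hM, hN, Matrix.mul_add, Matrix.add_mul, Finset.sum_add_distrib]
  rw [hL]
  exact Matrix.posSemidef_sum _ fun i _ => hM.mul_mul_conjTranspose_same _

/-- The dual of a linear map of matrix algebras with respect to the trace pairing. -/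
noncomputable def traceDual [Fintype n₁] (Φ : Matrix n n ℂ →ₗ[ℂ] Matrix n₁ n₁ ℂ)
    (M : Matrix n₁ n₁ ℂ) : Matrix n n ℂ :=
  Matrix.of fun i j => (M * Φ (Matrix.single j i 1)).trace

theorem trace_traceDual_mul [Fintype n₁] (Φ : Matrix n n ℂ →ₗ[ℂ] Matrix n₁ n₁ ℂ)
    (M : Matrix n₁ n₁ ℂ) (X : Matrix n n ℂ) :
    (traceDual Φ M * X).trace = (M * Φ X).trace := by
  induction X using Matrix.induction_on' with
  | h_zero => simp
  | h_add X Y hX hY => simp only [mul_add, map_add, Matrix.trace_add, hX, hY]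
  | h_std_basis i j c =>
    rw [Matrix.trace_mul_single, ← mul_one c, ← smul_eq_mul, ← Matrix.smul_single, map_smul,
      Matrix.mul_smul, Matrix.trace_smul]
    simp [traceDual, mul_comm]

end LinearMaps

section Measurements

theorem exists_isPOVM {n α : Type*} [DecidableEq n] [Fintype α] [Nonempty α] :
    ∃ M : α → Matrix n n ℂ, IsPOVM M := by
  classical
  inhabit α
  refine ⟨Pi.single default 1, fun a => ?_, by simp⟩
  rcases eq_or_ne a default with rfl | ha
  · simpa using Matrix.PosSemidef.one
  · simpa [ha] using Matrix.PosSemidef.zero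

variable {n m κ α : Type*} [DecidableEq n] [Fintype α]

open scoped Matrix.Norms.L2Operator MatrixOrder in
theorem IsPOVM.norm_le_one [Fintype n] {M : α → Matrix n n ℂ} (hM : IsPOVM M) (a : α) :
    ‖M a‖ ≤ 1 := by
  have hnonneg (b : α) : 0 ≤ M b := (hM.1 b).nonneg
  rw [CStarAlgebra.norm_le_one_iff_of_nonneg (M a) (hnonneg a), ← hM.2]
  exact Finset.single_le_sum (fun b _ => hnonneg b) (Finset.mem_univ a)

open scoped Matrix.Norms.L2Operator MatrixOrder in
theorem isClosed_setOf_isPOVM [Finite n] : IsClosed {M : α → Matrix n n ℂ | IsPOVM M} := by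
  have := Fintype.ofFinite n
  simp only [IsPOVM, ← Matrix.nonneg_iff_posSemidef, Set.ofPred_and, Set.ofPred_forall]
  refine (isClosed_iInter fun a => ?_).inter (isClosed_eq (by fun_prop) continuous_const)
  exact IsClosed.preimage (continuous_apply (A := fun _ => Matrix n n ℂ) a)
    (CStarAlgebra.isClosed_nonneg (A := Matrix n n ℂ))

open scoped Matrix.Norms.L2Operator in
theorem isCompact_setOf_isPOVM [Finite n] : IsCompact {M : α → Matrix n n ℂ | IsPOVM M} := by
  have := Fintype.ofFinite n
  have : ProperSpace (α → Matrix n n ℂ) := FiniteDimensional.proper ℂ _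
  refine Metric.isCompact_of_isClosed_isBounded isClosed_setOf_isPOVM ?_
  refine (Metric.isBounded_closedBall (x := 0) (r := 1)).subset fun M hM => ?_
  rw [mem_closedBall_zero_iff, pi_norm_le_iff_of_nonneg zero_le_one]
  exact hM.norm_le_one

variable [Fintype n] [Fintype m] [DecidableEq m]

theorem IsPOVM.traceDual {Φ : Matrix n n ℂ →ₗ[ℂ] Matrix m m ℂ}
    (hpos : ∀ X, X.PosSemidef → (Φ X).PosSemidef) (htr : ∀ X, (Φ X).trace = X.trace)
    {M : α → Matrix m m ℂ} (hM : IsPOVM M) : IsPOVM fun a => traceDual Φ (M a) := by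
  refine ⟨fun a => posSemidef_of_trace_mul_nonneg fun X hX => ?_,
    Matrix.ext_iff_trace_mul_right.2 fun X => ?_⟩
  · rw [trace_traceDual_mul]
    exact trace_mul_nonneg (hM.1 a) (hpos X hX)
  · simp only [Finset.sum_mul, Matrix.trace_sum, trace_traceDual_mul]
    rw [← Matrix.trace_sum, ← Finset.sum_mul, hM.2, one_mul, one_mul, htr]

theorem IsPOVM.traceDual_tensorMap_id_left [Fintype κ] [DecidableEq κ]
    {Φ : Matrix n n ℂ →ₗ[ℂ] Matrix m m ℂ} (hΦ : IsChannel Φ)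
    {M : α → Matrix (κ × m) (κ × m) ℂ} (hM : IsPOVM M) :
    IsPOVM fun a => LOSRWitness.traceDual (tensorMap LinearMap.id Φ) (M a) :=
  hM.traceDual (fun _ => hΦ.1.tensorMap_id_left) (trace_tensorMap_id_left hΦ.2)

theorem isPOVM_basisMeasurement (ψ : OrthonormalBasis α ℂ (EuclideanSpace ℂ n)) :
    IsPOVM (basisMeasurement ψ) := by
  refine ⟨fun a => Matrix.posSemidef_vecMulVec_self_star _, ?_⟩
  ext i j
  have h := ψ.sum_inner_mul_inner (EuclideanSpace.single i (1 : ℂ)) (EuclideanSpace.single j 1)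
  simpa [basisMeasurement, ketbra, Matrix.sum_apply, EuclideanSpace.inner_single_left,
    EuclideanSpace.inner_single_right, Matrix.one_apply, eq_comm, PiLp.single_apply] using h

end Measurements

section Convexity

variable {V : Type*} [AddCommGroup V] [Module ℝ V] [TopologicalSpace V] [IsTopologicalAddGroup V]
  [ContinuousSMul ℝ V] [FiniteDimensional ℝ V] {s : Set V}

/-- By Carathéodory's theorem it suffices to consider combinations of at most `finrank ℝ V + 1`
points, which are parametrized by finitely many compact sets. -/
theorem isCompact_convexHull (hs : IsCompact s) : IsCompact (convexHull ℝ s) := by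
  let combination (k : ℕ) (t : (Fin k → ℝ) × (Fin k → V)) : V := ∑ i, t.1 i • t.2 i
  let parameters (k : ℕ) : Set ((Fin k → ℝ) × (Fin k → V)) :=
    stdSimplex ℝ (Fin k) ×ˢ Set.univ.pi fun _ => s
  have hcompact (k : ℕ) : IsCompact (combination k '' parameters k) :=
    ((isCompact_stdSimplex ℝ (Fin k)).prod (isCompact_univ_pi fun _ => hs)).image (by fun_prop)
  suffices h : convexHull ℝ s =
      ⋃ k ∈ Finset.range (Module.finrank ℝ V + 2), combination k '' parameters k by
    rw [h]
    exact Finset.isCompact_biUnion _ fun k _ => hcompact k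
  refine Set.Subset.antisymm (fun v hv => ?_) (Set.iUnion₂_subset fun k _ => ?_)
  · obtain ⟨ι, _, z, w, hz, hind, hw, hw1, rfl⟩ := eq_pos_convex_span_of_mem_convexHull hv
    let e := (Fintype.equivFin ι).symm
    have hcard : Fintype.card ι ≤ Module.finrank ℝ V + 1 :=
      hind.card_le_finrank_succ.trans (Nat.add_le_add_right (Submodule.finrank_le _) 1)
    refine Set.mem_biUnion (Finset.mem_coe.2 (Finset.mem_range_succ_iff.2 hcard))
      ⟨(w ∘ e, z ∘ e), ⟨⟨fun i => (hw _).le, ?_⟩, fun i _ => hz ⟨_, rfl⟩⟩, ?_⟩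
    · exact (e.sum_comp w).trans hw1
    · exact e.sum_comp fun i => w i • z i
  · rintro _ ⟨t, ⟨ht, hts⟩, rfl⟩
    exact mem_convexHull_of_exists_fintype t.1 t.2 ht.1 ht.2 (fun i => hts i trivial) rfl

theorem mem_convexHull_iff_forall_le_sSup [T2Space V] [LocallyConvexSpace ℝ V] (hs : IsCompact s)
    (hne : s.Nonempty) {v : V} :
    v ∈ convexHull ℝ s ↔ ∀ f : V →L[ℝ] ℝ, f v ≤ sSup (f '' s) := by
  have hgreatest (f : V →L[ℝ] ℝ) : IsGreatest (f '' s) (sSup (f '' s)) :=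
    (hs.image f.continuous).isGreatest_sSup (hne.image f)
  refine ⟨fun hv f => ?_, fun h => ?_⟩
  · have hsub : convexHull ℝ s ⊆ {v | f v ≤ sSup (f '' s)} :=
      convexHull_min (fun u hu => (hgreatest f).2 ⟨u, hu, rfl⟩)
        (convex_halfSpace_le f.toLinearMap.isLinear _)
    exact hsub hv
  · by_contra hv
    obtain ⟨f, u, hfs, hfv⟩ := geometric_hahn_banach_closed_point (convex_convexHull ℝ s)
      (isCompact_convexHull hs).isClosed hv
    obtain ⟨p, hp, hfp⟩ := (hgreatest f).1
    have hlt : sSup (f '' s) < f v := hfp ▸ (hfs p (subset_convexHull ℝ s hp)).trans hfv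
    exact (h f).not_gt hlt

end Convexity

section LocalBehaviours

variable {m n X Y α β : Type*}

section Value

variable [Fintype X] [Fintype Y] [Fintype α] [Fintype β]

theorem isLinearMap_value (γ : α → β → X → Y → ℝ) : IsLinearMap ℝ (value γ) where
  map_add p q := by simp only [value, Pi.add_apply, mul_add, Finset.sum_add_distrib]
  map_smul c p := by
    simp only [value, Pi.smul_apply, smul_eq_mul, Finset.mul_sum, mul_left_comm]

theorem exists_eq_value (f : (α → β → X → Y → ℝ) →ₗ[ℝ] ℝ) : ∃ γ, ⇑f = value γ := by
  classical
  let γ : α → β → X → Y → ℝ := fun a b x y =>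
    f (Pi.single a (Pi.single b (Pi.single x (Pi.single y 1))))
  suffices h : f = (isLinearMap_value γ).mk' (value γ) from ⟨γ, congrArg DFunLike.coe h⟩
  ext a b x y
  simp [value, γ, Pi.single_apply, ite_apply, apply_ite]

end Value

/-- The behaviour obtained by measuring the two inputs independently: the product
`Tr(Mᵃ ρˣ) Tr(Nᵇ σʸ)` of the two local outcome distributions. -/
noncomputable def localBehaviour [Fintype m] [Fintype n] (ρ : X → Matrix m m ℂ)
    (σ : Y → Matrix n n ℂ) (M : α → Matrix m m ℂ) (N : β → Matrix n n ℂ) (a : α) (b : β) (x : X)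
    (y : Y) : ℝ :=
  ((M a * ρ x).trace).re * ((N b * σ y).trace).re

theorem continuous_localBehaviour [Fintype m] [Fintype n] (ρ : X → Matrix m m ℂ)
    (σ : Y → Matrix n n ℂ) :
    Continuous fun t : (α → Matrix m m ℂ) × (β → Matrix n n ℂ) => localBehaviour ρ σ t.1 t.2 := by
  unfold localBehaviour
  fun_prop

variable [Fintype m] [DecidableEq m] [Fintype n] [DecidableEq n] [Fintype α] [Fintype β]

/-- The behaviours `localBehaviour ρ σ M N` of all pairs of measurements `M`, `N`; the values of a
functional on this set are its `localValues`. -/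
def localBehaviours (α β : Type*) [Fintype α] [Fintype β] (ρ : X → Matrix m m ℂ)
    (σ : Y → Matrix n n ℂ) : Set (α → β → X → Y → ℝ) :=
  (fun t => localBehaviour ρ σ t.1 t.2) '' ({M | IsPOVM M} ×ˢ {N | IsPOVM N})

variable (ρ : X → Matrix m m ℂ) (σ : Y → Matrix n n ℂ)

theorem isCompact_localBehaviours : IsCompact (localBehaviours α β ρ σ) :=
  (isCompact_setOf_isPOVM.prod isCompact_setOf_isPOVM).image (continuous_localBehaviour ρ σ)

theorem localBehaviours_nonempty [Nonempty α] [Nonempty β] : (localBehaviours α β ρ σ).Nonempty :=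
  (Set.Nonempty.prod exists_isPOVM exists_isPOVM).image _

variable [Fintype X] [Fintype Y]

theorem image_value_localBehaviours (γ : α → β → X → Y → ℝ) :
    value γ '' localBehaviours α β ρ σ = localValues ρ σ γ := by
  ext v
  constructor
  · rintro ⟨_, ⟨⟨M, N⟩, ⟨hM, hN⟩, rfl⟩, rfl⟩
    exact ⟨M, N, hM, hN, rfl⟩
  · rintro ⟨M, N, hM, hN, rfl⟩
    exact ⟨_, ⟨(M, N), ⟨hM, hN⟩, rfl⟩, rfl⟩

variable [Nonempty α] [Nonempty β]

theorem isGreatest_localMax (γ : α → β → X → Y → ℝ) :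
    IsGreatest (localValues ρ σ γ) (localMax ρ σ γ) := by
  have hcont : Continuous (value γ) := ((isLinearMap_value γ).mk' _).continuous_of_finiteDimensional
  have hgreatest := ((isCompact_localBehaviours ρ σ).image hcont).isGreatest_sSup
    ((localBehaviours_nonempty ρ σ).image _)
  rwa [image_value_localBehaviours] at hgreatest

theorem mem_convexHull_localBehaviours_iff {p : α → β → X → Y → ℝ} :
    p ∈ convexHull ℝ (localBehaviours α β ρ σ) ↔ ∀ γ, value γ p ≤ localMax ρ σ γ := by
  rw [mem_convexHull_iff_forall_le_sSup (isCompact_localBehaviours ρ σ)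
    (localBehaviours_nonempty ρ σ)]
  constructor
  · intro h γ
    rw [localMax, ← image_value_localBehaviours]
    exact h ((isLinearMap_value γ).mk' _).toContinuousLinearMap
  · intro h f
    obtain ⟨γ, hγ⟩ := exists_eq_value (f : (α → β → X → Y → ℝ) →ₗ[ℝ] ℝ)
    rw [ContinuousLinearMap.coe_coe] at hγ
    rw [hγ, image_value_localBehaviours]
    exact h γ

end LocalBehaviours

section Extension

variable {A₀ A₁ B₀ B₁ R S : Type*} [Fintype A₀] [DecidableEq A₀] [Fintype B₀] [DecidableEq B₀]
  [Fintype R] [DecidableEq R] [Fintype S] [DecidableEq S]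

/-- `extend R S E X` as a bilinear map in `E` and `X`. -/
noncomputable def extendBilin (A₀ A₁ B₀ B₁ R S : Type*) [Fintype A₀] [DecidableEq A₀]
    [Fintype B₀] [DecidableEq B₀] [Fintype R] [DecidableEq R] [Fintype S] [DecidableEq S] :
    (Matrix (A₀ × B₀) (A₀ × B₀) ℂ →ₗ[ℂ] Matrix (A₁ × B₁) (A₁ × B₁) ℂ) →ₗ[ℂ]
      Matrix ((R × A₀) × (S × B₀)) ((R × A₀) × (S × B₀)) ℂ →ₗ[ℂ]
        Matrix ((R × A₁) × (S × B₁)) ((R × A₁) × (S × B₁)) ℂ :=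
  LinearMap.mk₂ ℂ (extend R S)
    (fun E F X => by simp [extend, tensorMap_add_left, Matrix.submatrix_add])
    (fun c E X => by simp [extend, tensorMap_smul_left, Matrix.submatrix_smul])
    (fun E X Y => by simp [extend, Matrix.submatrix_add])
    (fun c E X => by simp [extend, Matrix.submatrix_smul])

theorem extendBilin_apply
    (E : Matrix (A₀ × B₀) (A₀ × B₀) ℂ →ₗ[ℂ] Matrix (A₁ × B₁) (A₁ × B₁) ℂ)
    (X : Matrix ((R × A₀) × (S × B₀)) ((R × A₀) × (S × B₀)) ℂ) :
    extendBilin A₀ A₁ B₀ B₁ R S E X = extend R S E X :=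
  rfl

theorem reindex_shuffle_symm_kronecker {A B R S : Type*} (G : Matrix R R ℂ) (T : Matrix A A ℂ)
    (H : Matrix S S ℂ) (Q : Matrix B B ℂ) :
    Matrix.reindex (shuffle R A S B).symm (shuffle R A S B).symm ((T ⊗ₖ Q) ⊗ₖ (G ⊗ₖ H)) =
      (G ⊗ₖ T) ⊗ₖ (H ⊗ₖ Q) := by
  ext p q
  simp only [shuffle, Matrix.reindex_apply, Matrix.submatrix_apply, Matrix.kroneckerMap_apply,
    Equiv.symm_symm, Equiv.coe_fn_mk]
  ring

theorem extend_kronecker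
    (E : Matrix (A₀ × B₀) (A₀ × B₀) ℂ →ₗ[ℂ] Matrix (A₁ × B₁) (A₁ × B₁) ℂ)
    (G : Matrix R R ℂ) (T : Matrix A₀ A₀ ℂ) (H : Matrix S S ℂ) (Q : Matrix B₀ B₀ ℂ) :
    extend R S E ((G ⊗ₖ T) ⊗ₖ (H ⊗ₖ Q)) =
      Matrix.reindex (shuffle R A₁ S B₁).symm (shuffle R A₁ S B₁).symm
        (E (T ⊗ₖ Q) ⊗ₖ (G ⊗ₖ H)) := by
  rw [extend, ← reindex_shuffle_symm_kronecker, ← Matrix.reindex_symm, ← Matrix.reindex_symm,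
    Equiv.apply_symm_apply, tensorMap_kronecker, LinearMap.id_apply]

theorem extend_tensorMap (F : Matrix A₀ A₀ ℂ →ₗ[ℂ] Matrix A₁ A₁ ℂ)
    (F' : Matrix B₀ B₀ ℂ →ₗ[ℂ] Matrix B₁ B₁ ℂ) (X : Matrix (R × A₀) (R × A₀) ℂ)
    (Y : Matrix (S × B₀) (S × B₀) ℂ) :
    extend R S (tensorMap F F') (X ⊗ₖ Y) =
      tensorMap (LinearMap.id : Matrix R R ℂ →ₗ[ℂ] Matrix R R ℂ) F X ⊗ₖ
        tensorMap (LinearMap.id : Matrix S S ℂ →ₗ[ℂ] Matrix S S ℂ) F' Y := by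
  have hadd := map_add (extendBilin A₀ A₁ B₀ B₁ R S (tensorMap F F'))
  induction X using kronecker_induction with
  | kronecker G T =>
    induction Y using kronecker_induction with
    | kronecker H Q =>
      simp only [extend_kronecker, tensorMap_kronecker, reindex_shuffle_symm_kronecker,
        LinearMap.id_apply]
    | add Y Y' hY hY' =>
      rw [Matrix.kronecker_add, map_add, Matrix.kronecker_add, ← hY, ← hY']
      exact hadd _ _
  | add X X' hX hX' =>
    rw [Matrix.add_kronecker, map_add, Matrix.add_kronecker, ← hX, ← hX']
    exact hadd _ _

theorem IsHermitianPreserving.isHermitian_extend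
    {E : Matrix (A₀ × B₀) (A₀ × B₀) ℂ →ₗ[ℂ] Matrix (A₁ × B₁) (A₁ × B₁) ℂ}
    (hE : IsHermitianPreserving E)
    {X : Matrix ((R × A₀) × (S × B₀)) ((R × A₀) × (S × B₀)) ℂ} (hX : X.IsHermitian) :
    (extend R S E X).IsHermitian :=
  ((hE.tensorMap isHermitianPreserving_id).isHermitian_apply (hX.submatrix _)).submatrix _

variable [Fintype A₁] [Fintype B₁] {X Y α β : Type*}

theorem ofReal_behaviour {E : Matrix (A₀ × B₀) (A₀ × B₀) ℂ →ₗ[ℂ] Matrix (A₁ × B₁) (A₁ × B₁) ℂ}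
    (hE : IsHermitianPreserving E)
    {ρ : X → Matrix (R × A₀) (R × A₀) ℂ} {σ : Y → Matrix (S × B₀) (S × B₀) ℂ}
    {M : α → Matrix (R × A₁) (R × A₁) ℂ} {N : β → Matrix (S × B₁) (S × B₁) ℂ}
    {a : α} {b : β} {x : X} {y : Y} (hM : (M a).IsHermitian) (hN : (N b).IsHermitian)
    (hρ : (ρ x).IsHermitian) (hσ : (σ y).IsHermitian) :
    (behaviour E ρ σ M N a b x y : ℂ) = ((M a ⊗ₖ N b) * extend R S E (ρ x ⊗ₖ σ y)).trace :=
  ofReal_re_trace_mul (isHermitian_kronecker hM hN)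
    (hE.isHermitian_extend (isHermitian_kronecker hρ hσ))

theorem ofReal_localBehaviour {m n : Type*} [Fintype m] [Fintype n]
    {ρ : X → Matrix m m ℂ} {σ : Y → Matrix n n ℂ} {M : α → Matrix m m ℂ} {N : β → Matrix n n ℂ}
    {a : α} {b : β} {x : X} {y : Y} (hM : (M a).IsHermitian) (hN : (N b).IsHermitian)
    (hρ : (ρ x).IsHermitian) (hσ : (σ y).IsHermitian) :
    (localBehaviour ρ σ M N a b x y : ℂ) = (M a * ρ x).trace * (N b * σ y).trace := by
  rw [localBehaviour, Complex.ofReal_mul, ofReal_re_trace_mul hM hρ, ofReal_re_trace_mul hN hσ]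

theorem behaviour_sum_smul {ι : Type*} [Fintype ι] (w : ι → ℝ)
    (E : ι → (Matrix (A₀ × B₀) (A₀ × B₀) ℂ →ₗ[ℂ] Matrix (A₁ × B₁) (A₁ × B₁) ℂ))
    (ρ : X → Matrix (R × A₀) (R × A₀) ℂ) (σ : Y → Matrix (S × B₀) (S × B₀) ℂ)
    (M : α → Matrix (R × A₁) (R × A₁) ℂ) (N : β → Matrix (S × B₁) (S × B₁) ℂ) :
    behaviour (∑ i, (w i : ℂ) • E i) ρ σ M N = ∑ i, w i • behaviour (E i) ρ σ M N := by
  ext a b x y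
  have h : extend R S (∑ i, (w i : ℂ) • E i) (ρ x ⊗ₖ σ y) =
      ∑ i, (w i : ℂ) • extend R S (E i) (ρ x ⊗ₖ σ y) := by
    simp only [← extendBilin_apply, LinearMap.map_sum₂, LinearMap.map_smul₂]
  simp [behaviour, h, Finset.mul_sum, Matrix.trace_sum]

theorem behaviour_tensorMap {F : Matrix A₀ A₀ ℂ →ₗ[ℂ] Matrix A₁ A₁ ℂ}
    (hF : IsHermitianPreserving F) (F' : Matrix B₀ B₀ ℂ →ₗ[ℂ] Matrix B₁ B₁ ℂ)
    {ρ : X → Matrix (R × A₀) (R × A₀) ℂ} (hρ : ∀ x, (ρ x).IsHermitian)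
    (σ : Y → Matrix (S × B₀) (S × B₀) ℂ)
    {M : α → Matrix (R × A₁) (R × A₁) ℂ} (hM : ∀ a, (M a).IsHermitian)
    (N : β → Matrix (S × B₁) (S × B₁) ℂ) :
    behaviour (tensorMap F F') ρ σ M N =
      localBehaviour ρ σ (fun a => traceDual (tensorMap LinearMap.id F) (M a))
        (fun b => traceDual (tensorMap LinearMap.id F') (N b)) := by
  ext a b x y
  have hreal := ofReal_re_trace_mul (hM a)
    ((isHermitianPreserving_id.tensorMap hF).isHermitian_apply (hρ x))
  rw [behaviour, extend_tensorMap, ← Matrix.mul_kronecker_mul, Matrix.trace_kronecker,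
    localBehaviour, trace_traceDual_mul, trace_traceDual_mul, ← hreal, Complex.re_ofReal_mul,
    Complex.ofReal_re]

theorem IsLOSR.behaviour_mem_convexHull [DecidableEq A₁] [DecidableEq B₁] [Fintype α] [Fintype β]
    {E : Matrix (A₀ × B₀) (A₀ × B₀) ℂ →ₗ[ℂ] Matrix (A₁ × B₁) (A₁ × B₁) ℂ} (hE : IsLOSR E)
    {ρ : X → Matrix (R × A₀) (R × A₀) ℂ} (hρ : ∀ x, (ρ x).IsHermitian)
    (σ : Y → Matrix (S × B₀) (S × B₀) ℂ)
    {M : α → Matrix (R × A₁) (R × A₁) ℂ} {N : β → Matrix (S × B₁) (S × B₁) ℂ}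
    (hM : IsPOVM M) (hN : IsPOVM N) :
    behaviour E ρ σ M N ∈ convexHull ℝ (localBehaviours α β ρ σ) := by
  obtain ⟨k, w, F, F', hw, hw1, hF, hF', rfl⟩ := hE
  refine mem_convexHull_of_exists_fintype w _ hw hw1 (fun i => ⟨(_, _),
    ⟨hM.traceDual_tensorMap_id_left (hF i), hN.traceDual_tensorMap_id_left (hF' i)⟩, rfl⟩) ?_
  rw [behaviour_sum_smul]
  refine Finset.sum_congr rfl fun i _ => ?_
  rw [behaviour_tensorMap (hF i).1.isHermitianPreserving _ hρ σ fun a => (hM.1 a).isHermitian]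
  rfl

theorem isLOSR_of_eq_sum {ι : Type*} [Fintype ι] {w : ι → ℝ} (hw : ∀ i, 0 ≤ w i)
    (hw1 : ∑ i, w i = 1) {F : ι → (Matrix A₀ A₀ ℂ →ₗ[ℂ] Matrix A₁ A₁ ℂ)}
    (hF : ∀ i, IsChannel (F i)) {F' : ι → (Matrix B₀ B₀ ℂ →ₗ[ℂ] Matrix B₁ B₁ ℂ)}
    (hF' : ∀ i, IsChannel (F' i))
    {E : Matrix (A₀ × B₀) (A₀ × B₀) ℂ →ₗ[ℂ] Matrix (A₁ × B₁) (A₁ × B₁) ℂ}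
    (hE : E = ∑ i, (w i : ℂ) • tensorMap (F i) (F' i)) : IsLOSR E := by
  let e := (Fintype.equivFin ι).symm
  refine ⟨_, w ∘ e, F ∘ e, F' ∘ e, fun i => hw _, (e.sum_comp w).trans hw1, fun i => hF _,
    fun i => hF' _, hE.trans ?_⟩
  exact (e.sum_comp fun i => (w i : ℂ) • tensorMap (F i) (F' i)).symm

end Extension

section Teleportation

variable {A A₀ R α : Type*}

/-- The block `⟨l|ω|k⟩` of an operator `ω` on `R ⊗ A`, an operator on `R`. -/
def sndBlock (ω : Matrix (R × A) (R × A) ℂ) (l k : A) : Matrix R R ℂ :=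
  ω.submatrix (·, l) (·, k)

theorem sum_sndBlock_self [Fintype A] (ω : Matrix (R × A) (R × A) ℂ) :
    ∑ l, sndBlock ω l l = traceSnd ω := by
  ext r s
  exact Matrix.sum_apply r s _ _

/-- The vector `v ∈ ℂᴿ ⊗ ℂᴬ` as an operator `ℂᴿ → ℂᴬ`. -/
def coeffMatrix (v : EuclideanSpace ℂ (R × A)) : Matrix A R ℂ :=
  Matrix.of fun i r => v (r, i)

theorem coeffMatrix_mul_conjTranspose_self [Fintype R] (v : EuclideanSpace ℂ (R × A)) :
    coeffMatrix v * (coeffMatrix v)ᴴ = traceFst (ketbra v) :=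
  rfl

variable [Fintype R] [Fintype A₀]

/-- The map `T ↦ Tr_{R A₀}((M ⊗ 1_A) (T ⊗ ω))` for an operator `ω` on `R ⊗ A` and an operator `M`
on `R ⊗ A₀`: the state of `A` after a teleportation with resource `ω` in which the measurement of
`R ⊗ A₀` has had the outcome corresponding to the effect `M`. It is bilinear in `M` and `T`. -/
noncomputable def teleport (ω : Matrix (R × A) (R × A) ℂ) :
    Matrix (R × A₀) (R × A₀) ℂ →ₗ[ℂ] Matrix A₀ A₀ ℂ →ₗ[ℂ] Matrix A A ℂ :=
  LinearMap.mk₂ ℂ (fun M T => Matrix.of fun l k => (M * (sndBlock ω l k ⊗ₖ T)).trace)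
    (fun M N T => by ext l k; simp [add_mul])
    (fun c M T => by ext l k; simp)
    (fun M T U => by ext l k; simp [Matrix.kronecker_add, mul_add])
    (fun c M T => by ext l k; simp [Matrix.kronecker_smul])

theorem teleport_apply (ω : Matrix (R × A) (R × A) ℂ) (M : Matrix (R × A₀) (R × A₀) ℂ)
    (T : Matrix A₀ A₀ ℂ) (l k : A) :
    teleport ω M T l k = (M * (sndBlock ω l k ⊗ₖ T)).trace :=
  rfl

theorem trace_teleport [Fintype A] (ω : Matrix (R × A) (R × A) ℂ)
    (M : Matrix (R × A₀) (R × A₀) ℂ) (T : Matrix A₀ A₀ ℂ) :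
    (teleport ω M T).trace = (M * (traceSnd ω ⊗ₖ T)).trace := by
  have hsum : ∑ l, sndBlock ω l l ⊗ₖ T = traceSnd ω ⊗ₖ T := by
    rw [← sum_sndBlock_self]
    exact (LinearMap.map_sum₂ (Matrix.kroneckerBilinear (R := ℂ)) _ _ T).symm
  rw [← hsum, Finset.mul_sum, Matrix.trace_sum]
  rfl

theorem teleport_ketbra_ketbra (v : EuclideanSpace ℂ (R × A)) (u : EuclideanSpace ℂ (R × A₀))
    (T : Matrix A₀ A₀ ℂ) :
    teleport (ketbra v) (ketbra u) T = (coeffMatrix v * (coeffMatrix u)ᴴ) * T *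
      (coeffMatrix v * (coeffMatrix u)ᴴ)ᴴ := by
  ext l k
  have hblock : (sndBlock (ketbra v) l k)ᵀ =
      Matrix.vecMulVec (star (coeffMatrix v k)) (coeffMatrix v l) := by
    ext r s
    exact mul_comm _ _
  have hu : ketbra u = Matrix.vecMulVec (coeffMatrix u).vec (star (coeffMatrix u).vec) := rfl
  calc teleport (ketbra v) (ketbra u) T l k
      = ((coeffMatrix u)ᴴ * (T * coeffMatrix u * (sndBlock (ketbra v) l k)ᵀ)).trace := by
        rw [teleport_apply, Matrix.trace_mul_comm, hu, trace_mul_vecMulVec,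
          Matrix.kronecker_mulVec_vec, Matrix.star_vec_dotProduct_vec]
    _ = coeffMatrix v l ⬝ᵥ (((coeffMatrix u)ᴴ * T * coeffMatrix u) *ᵥ star (coeffMatrix v k)) := by
        rw [hblock, ← Matrix.mul_assoc, ← Matrix.mul_assoc, trace_mul_vecMulVec]
    _ = (coeffMatrix v * ((coeffMatrix u)ᴴ * T * coeffMatrix u) * (coeffMatrix v)ᴴ) l k := by
        rw [Matrix.mul_assoc (coeffMatrix v)]
        rfl
    _ = _ := by
        rw [Matrix.conjTranspose_mul, Matrix.conjTranspose_conjTranspose]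
        simp only [Matrix.mul_assoc]

variable [Fintype α]

/-- Teleportation with the resources `ω a` and the measurement `M`, summed over the outcomes. -/
noncomputable def teleportation (ω : α → Matrix (R × A) (R × A) ℂ)
    (M : α → Matrix (R × A₀) (R × A₀) ℂ) : Matrix A₀ A₀ ℂ →ₗ[ℂ] Matrix A A ℂ :=
  ∑ a, teleport (ω a) (M a)

theorem teleportation_eq_sum (ω : α → Matrix (R × A) (R × A) ℂ)
    (M : α → Matrix (R × A₀) (R × A₀) ℂ) (T : Matrix A₀ A₀ ℂ) :
    teleportation ω M T = ∑ a, teleport (ω a) (M a) T :=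
  LinearMap.sum_apply _ _ _

theorem teleportation_apply (ω : α → Matrix (R × A) (R × A) ℂ)
    (M : α → Matrix (R × A₀) (R × A₀) ℂ) (T : Matrix A₀ A₀ ℂ) (l k : A) :
    teleportation ω M T l k = ∑ a, (M a * (sndBlock (ω a) l k ⊗ₖ T)).trace := by
  rw [teleportation_eq_sum, Matrix.sum_apply]
  rfl

theorem isCompletelyPositive_teleportation [Finite A] [DecidableEq A₀]
    (v : α → EuclideanSpace ℂ (R × A)) {M : α → Matrix (R × A₀) (R × A₀) ℂ}
    (hM : ∀ a, (M a).PosSemidef) :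
    IsCompletelyPositive (teleportation (fun a => ketbra (v a)) M) := by
  choose k u hu using fun a => Matrix.posSemidef_iff_eq_sum_vecMulVec.1 (hM a)
  let K (c : Σ a, Fin (k a)) : Matrix A A₀ ℂ :=
    coeffMatrix (v c.1) * (coeffMatrix (WithLp.toLp 2 (u c.1 c.2)))ᴴ
  refine isCompletelyPositive_of_kraus K fun T => ?_
  rw [teleportation_eq_sum, Fintype.sum_sigma]
  refine Finset.sum_congr rfl fun a _ => ?_
  rw [hu a, map_sum, LinearMap.sum_apply]
  exact Finset.sum_congr rfl fun i _ => teleport_ketbra_ketbra (v a) (WithLp.toLp 2 (u a i)) T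

section Bell

variable [DecidableEq R] [Fintype A] [DecidableEq A]
  {ψ : OrthonormalBasis α ℂ (EuclideanSpace ℂ (R × A))}

theorem IsBellBasis.trace_teleportation [DecidableEq A₀] [Nonempty R] (hψ : IsBellBasis ψ)
    {M : α → Matrix (R × A₀) (R × A₀) ℂ} (hM : ∑ a, M a = 1) (T : Matrix A₀ A₀ ℂ) :
    (teleportation (basisMeasurement ψ) M T).trace = T.trace := by
  have htrace (a : α) : (teleport (basisMeasurement ψ a) (M a) T).trace =
      (1 / (Fintype.card R : ℂ)) * (M a * ((1 : Matrix R R ℂ) ⊗ₖ T)).trace := by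
    rw [trace_teleport, basisMeasurement, (hψ a).2, Matrix.smul_kronecker, Matrix.mul_smul,
      Matrix.trace_smul, smul_eq_mul]
  rw [teleportation_eq_sum, Matrix.trace_sum]
  simp only [htrace]
  rw [← Finset.mul_sum, ← Matrix.trace_sum, ← Finset.sum_mul, hM, one_mul, Matrix.trace_kronecker,
    Matrix.trace_one, ← mul_assoc, one_div_mul_cancel (Nat.cast_ne_zero.2 Fintype.card_ne_zero),
    one_mul]

theorem IsBellBasis.isChannel_teleportation [DecidableEq A₀] [Nonempty R] (hψ : IsBellBasis ψ)
    {M : α → Matrix (R × A₀) (R × A₀) ℂ} (hM : IsPOVM M) :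
    IsChannel (teleportation (basisMeasurement ψ) M) :=
  ⟨isCompletelyPositive_teleportation ψ hM.1, hψ.trace_teleportation hM.2⟩

/-- Each outcome contributes the same multiple of the identity, and the multiples add up to one
because teleportation preserves the trace. -/
theorem IsBellBasis.teleportation_basisMeasurement [Nonempty R] [Nonempty A]
    (hψ : IsBellBasis ψ) :
    teleportation (basisMeasurement ψ) (basisMeasurement ψ) = LinearMap.id := by
  obtain ⟨c, hc⟩ : ∃ c : ℂ, ∀ T,
      teleportation (basisMeasurement ψ) (basisMeasurement ψ) T = c • T := by
    refine ⟨∑ _a : α, (1 / (Fintype.card A : ℂ)) ^ 2, fun T => ?_⟩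
    rw [teleportation_eq_sum, Finset.sum_smul]
    refine Finset.sum_congr rfl fun a _ => ?_
    rw [basisMeasurement, teleport_ketbra_ketbra, coeffMatrix_mul_conjTranspose_self, (hψ a).1]
    simp [smul_smul, sq]
  have hc1 : c = 1 := by
    have htrace := hψ.trace_teleportation (isPOVM_basisMeasurement ψ).2 1
    rw [hc, Matrix.trace_smul, smul_eq_mul] at htrace
    exact mul_right_cancel₀ (by simp) (htrace.trans (one_mul _).symm)
  exact LinearMap.ext fun T => by rw [hc, hc1, one_smul, LinearMap.id_apply]

end Bell

end Teleportation

section Reconstruction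

variable {A₀ A₁ B₀ B₁ R S X Y α β : Type*} [Fintype A₀] [DecidableEq A₀]
  [Fintype A₁] [Fintype B₀] [DecidableEq B₀] [Fintype B₁]
  [Fintype R] [DecidableEq R] [Fintype S] [DecidableEq S]

theorem trace_extend_eq_of_span {ι : Type*} [Fintype ι]
    {ρ : X → Matrix (R × A₀) (R × A₀) ℂ} {σ : Y → Matrix (S × B₀) (S × B₀) ℂ}
    (hρ : Submodule.span ℂ (Set.range ρ) = ⊤) (hσ : Submodule.span ℂ (Set.range σ) = ⊤)
    {E : Matrix (A₀ × B₀) (A₀ × B₀) ℂ →ₗ[ℂ] Matrix (A₁ × B₁) (A₁ × B₁) ℂ}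
    {C : Matrix ((R × A₁) × (S × B₁)) ((R × A₁) × (S × B₁)) ℂ} {w : ι → ℂ}
    {M : ι → Matrix (R × A₀) (R × A₀) ℂ} {N : ι → Matrix (S × B₀) (S × B₀) ℂ}
    (h : ∀ x y, (C * extend R S E (ρ x ⊗ₖ σ y)).trace =
      ∑ i, w i * ((M i * ρ x).trace * (N i * σ y).trace))
    (P : Matrix (R × A₀) (R × A₀) ℂ) (Q : Matrix (S × B₀) (S × B₀) ℂ) :
    (C * extend R S E (P ⊗ₖ Q)).trace = ∑ i, w i * ((M i * P).trace * (N i * Q).trace) := by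
  let F : Matrix (R × A₀) (R × A₀) ℂ →ₗ[ℂ] Matrix (S × B₀) (S × B₀) ℂ →ₗ[ℂ] ℂ :=
    Matrix.kroneckerBilinear.compr₂
      (Matrix.traceLinearMap _ ℂ ℂ ∘ₗ LinearMap.mulLeft ℂ C ∘ₗ extendBilin A₀ A₁ B₀ B₁ R S E)
  let G : Matrix (R × A₀) (R × A₀) ℂ →ₗ[ℂ] Matrix (S × B₀) (S × B₀) ℂ →ₗ[ℂ] ℂ :=
    ∑ i, w i • (LinearMap.mul ℂ ℂ).compl₁₂
      (Matrix.traceLinearMap _ ℂ ℂ ∘ₗ LinearMap.mulLeft ℂ (M i))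
      (Matrix.traceLinearMap _ ℂ ℂ ∘ₗ LinearMap.mulLeft ℂ (N i))
  have hG (P Q) : G P Q = ∑ i, w i * ((M i * P).trace * (N i * Q).trace) := by
    simp [G, LinearMap.sum_apply]
  have hFG : F = G := LinearMap.ext_on_range hρ fun x => LinearMap.ext_on_range hσ fun y => by
    rw [hG]
    exact h x y
  rw [← hG, ← hFG]
  rfl

variable [DecidableEq A₁] [DecidableEq B₁] [Fintype α] [Fintype β]

theorem tensorMap_teleportation_apply
    (ω : α → Matrix (R × A₁) (R × A₁) ℂ) (τ : β → Matrix (S × B₁) (S × B₁) ℂ)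
    (M : α → Matrix (R × A₁) (R × A₁) ℂ) (N : β → Matrix (S × B₁) (S × B₁) ℂ)
    (E : Matrix (A₀ × B₀) (A₀ × B₀) ℂ →ₗ[ℂ] Matrix (A₁ × B₁) (A₁ × B₁) ℂ)
    (T : Matrix A₀ A₀ ℂ) (Q : Matrix B₀ B₀ ℂ) (p q : A₁ × B₁) :
    tensorMap (teleportation ω M) (teleportation τ N) (E (T ⊗ₖ Q)) p q =
      ∑ a, ∑ b, ((M a ⊗ₖ N b) * extend R S E
        ((sndBlock (ω a) p.1 q.1 ⊗ₖ T) ⊗ₖ (sndBlock (τ b) p.2 q.2 ⊗ₖ Q))).trace := by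
  simp only [extend_kronecker]
  induction E (T ⊗ₖ Q) using kronecker_induction with
  | kronecker Z W =>
    simp only [tensorMap_kronecker, Matrix.kroneckerMap_apply, teleportation_apply,
      Finset.sum_mul_sum, reindex_shuffle_symm_kronecker, ← Matrix.mul_kronecker_mul,
      Matrix.trace_kronecker]
  | add Z W hZ hW =>
    simp only [map_add, Matrix.add_apply, hZ, hW, ← Finset.sum_add_distrib, ← Matrix.trace_add,
      ← mul_add, Matrix.add_kronecker]
    rfl

theorem tensorMap_teleportation_comp {ι : Type*} [Fintype ι]
    (ω : α → Matrix (R × A₁) (R × A₁) ℂ) (τ : β → Matrix (S × B₁) (S × B₁) ℂ)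
    {M : α → Matrix (R × A₁) (R × A₁) ℂ} {N : β → Matrix (S × B₁) (S × B₁) ℂ}
    {E : Matrix (A₀ × B₀) (A₀ × B₀) ℂ →ₗ[ℂ] Matrix (A₁ × B₁) (A₁ × B₁) ℂ} {w : ι → ℂ}
    {M' : ι → α → Matrix (R × A₀) (R × A₀) ℂ} {N' : ι → β → Matrix (S × B₀) (S × B₀) ℂ}
    (h : ∀ a b P Q, ((M a ⊗ₖ N b) * extend R S E (P ⊗ₖ Q)).trace =
      ∑ i, w i * ((M' i a * P).trace * (N' i b * Q).trace)) :
    tensorMap (teleportation ω M) (teleportation τ N) ∘ₗ E =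
      ∑ i, w i • tensorMap (teleportation ω (M' i)) (teleportation τ (N' i)) := by
  refine LinearMap.ext fun Z => ?_
  induction Z using kronecker_induction with
  | add Z W hZ hW => rw [map_add, map_add, hZ, hW]
  | kronecker T Q =>
    ext p q
    simp only [LinearMap.comp_apply, tensorMap_teleportation_apply, h, LinearMap.sum_apply,
      LinearMap.smul_apply, tensorMap_kronecker, Matrix.sum_apply, Matrix.smul_apply,
      Matrix.kroneckerMap_apply, teleportation_apply, Finset.sum_mul_sum, smul_eq_mul]
    simp only [Finset.mul_sum]
    rw [Finset.sum_comm (s := (Finset.univ : Finset ι))]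
    exact Finset.sum_congr rfl fun a _ => Finset.sum_comm

theorem isLOSR_of_behaviour_mem_convexHull [Nonempty R] [Nonempty S] [Nonempty A₁] [Nonempty B₁]
    {ρ : X → Matrix (R × A₀) (R × A₀) ℂ} {σ : Y → Matrix (S × B₀) (S × B₀) ℂ}
    (hρ : ∀ x, (ρ x).IsHermitian) (hσ : ∀ y, (σ y).IsHermitian)
    (hρ_span : Submodule.span ℂ (Set.range ρ) = ⊤) (hσ_span : Submodule.span ℂ (Set.range σ) = ⊤)
    {ψ : OrthonormalBasis α ℂ (EuclideanSpace ℂ (R × A₁))}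
    {φ : OrthonormalBasis β ℂ (EuclideanSpace ℂ (S × B₁))}
    (hψ : IsBellBasis ψ) (hφ : IsBellBasis φ)
    {E : Matrix (A₀ × B₀) (A₀ × B₀) ℂ →ₗ[ℂ] Matrix (A₁ × B₁) (A₁ × B₁) ℂ}
    (hE : IsHermitianPreserving E)
    (hmem : behaviour E ρ σ (basisMeasurement ψ) (basisMeasurement φ) ∈
      convexHull ℝ (localBehaviours α β ρ σ)) : IsLOSR E := by
  obtain ⟨ι, _, w, p, hw, hw1, hp, hsum⟩ := mem_convexHull_iff_exists_fintype.1 hmem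
  choose MN hMN hloc using hp
  have htrace (a b x y) : ((basisMeasurement ψ a ⊗ₖ basisMeasurement φ b) *
      extend R S E (ρ x ⊗ₖ σ y)).trace =
        ∑ i, (w i : ℂ) * (((MN i).1 a * ρ x).trace * ((MN i).2 b * σ y).trace) := by
    rw [← ofReal_behaviour hE ((isPOVM_basisMeasurement ψ).1 a).isHermitian
      ((isPOVM_basisMeasurement φ).1 b).isHermitian (hρ x) (hσ y), ← hsum]
    simp only [← hloc, Finset.sum_apply, Pi.smul_apply, smul_eq_mul, Complex.ofReal_sum,
      Complex.ofReal_mul, ofReal_localBehaviour ((hMN _).1.1 a).isHermitian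
        ((hMN _).2.1 b).isHermitian (hρ x) (hσ y)]
  refine isLOSR_of_eq_sum hw hw1 (fun i => hψ.isChannel_teleportation (hMN i).1)
    (fun i => hφ.isChannel_teleportation (hMN i).2) ?_
  rw [← tensorMap_teleportation_comp _ _ fun a b => trace_extend_eq_of_span hρ_span hσ_span
    (htrace a b), hψ.teleportation_basisMeasurement, hφ.teleportation_basisMeasurement,
    tensorMap_id_id, LinearMap.id_comp]

theorem isLOSR_iff_behaviour_mem_convexHull [Nonempty R] [Nonempty S] [Nonempty A₁] [Nonempty B₁]
    {ρ : X → Matrix (R × A₀) (R × A₀) ℂ} {σ : Y → Matrix (S × B₀) (S × B₀) ℂ}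
    (hρ : ∀ x, (ρ x).IsHermitian) (hσ : ∀ y, (σ y).IsHermitian)
    (hρ_span : Submodule.span ℂ (Set.range ρ) = ⊤) (hσ_span : Submodule.span ℂ (Set.range σ) = ⊤)
    {ψ : OrthonormalBasis α ℂ (EuclideanSpace ℂ (R × A₁))}
    {φ : OrthonormalBasis β ℂ (EuclideanSpace ℂ (S × B₁))}
    (hψ : IsBellBasis ψ) (hφ : IsBellBasis φ)
    {E : Matrix (A₀ × B₀) (A₀ × B₀) ℂ →ₗ[ℂ] Matrix (A₁ × B₁) (A₁ × B₁) ℂ}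
    (hE : IsHermitianPreserving E) :
    IsLOSR E ↔ behaviour E ρ σ (basisMeasurement ψ) (basisMeasurement φ) ∈
      convexHull ℝ (localBehaviours α β ρ σ) :=
  ⟨fun h => h.behaviour_mem_convexHull hρ σ (isPOVM_basisMeasurement ψ) (isPOVM_basisMeasurement φ),
    isLOSR_of_behaviour_mem_convexHull hρ hσ hρ_span hσ_span hψ hφ hE⟩

end Reconstruction

end LOSRWitness

theorem mainTheorem4_general {A₀ A₁ B₀ B₁ R S X Y α β : Type*}
    [Fintype A₀] [DecidableEq A₀] [Fintype A₁] [DecidableEq A₁] [Nonempty A₁]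
    [Fintype B₀] [DecidableEq B₀] [Fintype B₁] [DecidableEq B₁] [Nonempty B₁]
    [Fintype R] [DecidableEq R] [Nonempty R] [Fintype S] [DecidableEq S] [Nonempty S]
    [Fintype X] [Fintype Y] [Fintype α] [Fintype β]
    (ρ : X → Matrix (R × A₀) (R × A₀) ℂ) (σ : Y → Matrix (S × B₀) (S × B₀) ℂ)
    (hρ : ∀ x, (ρ x).IsHermitian) (hσ : ∀ y, (σ y).IsHermitian)
    (hρ_span : Submodule.span ℂ (Set.range ρ) = ⊤) (hσ_span : Submodule.span ℂ (Set.range σ) = ⊤)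
    (ψ : OrthonormalBasis α ℂ (EuclideanSpace ℂ (R × A₁)))
    (φ : OrthonormalBasis β ℂ (EuclideanSpace ℂ (S × B₁)))
    (hψ : LOSRWitness.IsBellBasis ψ) (hφ : LOSRWitness.IsBellBasis φ) :
    (∀ γ : α → β → X → Y → ℝ,
      IsGreatest (LOSRWitness.localValues ρ σ γ) (LOSRWitness.localMax ρ σ γ)) ∧
    (∀ E : Matrix (A₀ × B₀) (A₀ × B₀) ℂ →ₗ[ℂ] Matrix (A₁ × B₁) (A₁ × B₁) ℂ,
      LOSRWitness.IsHermitianPreserving E →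
      (¬ LOSRWitness.IsLOSR E ↔
        ∃ γ : α → β → X → Y → ℝ,
          LOSRWitness.value γ (LOSRWitness.behaviour E ρ σ
            (LOSRWitness.basisMeasurement ψ) (LOSRWitness.basisMeasurement φ)) >
          LOSRWitness.localMax ρ σ γ)) ∧
    (∀ (γ : α → β → X → Y → ℝ)
      (E : Matrix (A₀ × B₀) (A₀ × B₀) ℂ →ₗ[ℂ] Matrix (A₁ × B₁) (A₁ × B₁) ℂ)
      (M : α → Matrix (R × A₁) (R × A₁) ℂ) (N : β → Matrix (S × B₁) (S × B₁) ℂ),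
      LOSRWitness.IsLOSR E → LOSRWitness.IsPOVM M → LOSRWitness.IsPOVM N →
        LOSRWitness.value γ (LOSRWitness.behaviour E ρ σ M N) ≤
          LOSRWitness.localMax ρ σ γ) := by
  have : Nonempty α := ψ.toBasis.index_nonempty
  have : Nonempty β := φ.toBasis.index_nonempty
  refine ⟨LOSRWitness.isGreatest_localMax ρ σ, fun E hE => ?_, fun γ E M N hE hM hN => ?_⟩
  · rw [LOSRWitness.isLOSR_iff_behaviour_mem_convexHull hρ hσ hρ_span hσ_span hψ hφ hE,
      LOSRWitness.mem_convexHull_localBehaviours_iff, not_forall]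
    exact exists_congr fun γ => not_le
  · exact (LOSRWitness.mem_convexHull_localBehaviours_iff ρ σ).1
      (hE.behaviour_mem_convexHull hρ σ hM hN) γ

theorem mainTheorem4 {A₀ A₁ B₀ B₁ R S X Y α β : Type*}
    [Fintype A₀] [DecidableEq A₀] [Nonempty A₀] [Fintype A₁] [DecidableEq A₁] [Nonempty A₁]
    [Fintype B₀] [DecidableEq B₀] [Nonempty B₀] [Fintype B₁] [DecidableEq B₁] [Nonempty B₁]
    [Fintype R] [DecidableEq R] [Nonempty R] [Fintype S] [DecidableEq S] [Nonempty S]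
    [Fintype X] [Fintype Y] [Fintype α] [Fintype β]
    (ρ : X → Matrix (R × A₀) (R × A₀) ℂ) (σ : Y → Matrix (S × B₀) (S × B₀) ℂ)
    (hρ : ∀ x, LOSRWitness.IsState (ρ x)) (hσ : ∀ y, LOSRWitness.IsState (σ y))
    (hρ_indep : LinearIndependent ℂ ρ) (hσ_indep : LinearIndependent ℂ σ)
    (hρ_span : Submodule.span ℂ (Set.range ρ) = ⊤)
    (hσ_span : Submodule.span ℂ (Set.range σ) = ⊤)
    (ψ : OrthonormalBasis α ℂ (EuclideanSpace ℂ (R × A₁)))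
    (φ : OrthonormalBasis β ℂ (EuclideanSpace ℂ (S × B₁)))
    (hψ : LOSRWitness.IsBellBasis ψ) (hφ : LOSRWitness.IsBellBasis φ) :
    -- the maximum over local measurements exists, for every functional
    (∀ γ : α → β → X → Y → ℝ,
      IsGreatest (LOSRWitness.localValues ρ σ γ) (LOSRWitness.localMax ρ σ γ)) ∧
    -- the characterization of non-LOSR channels
    (∀ E : Matrix (A₀ × B₀) (A₀ × B₀) ℂ →ₗ[ℂ] Matrix (A₁ × B₁) (A₁ × B₁) ℂ,
      LOSRWitness.IsChannel E →
      (¬ LOSRWitness.IsLOSR E ↔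
        ∃ γ : α → β → X → Y → ℝ,
          LOSRWitness.value γ (LOSRWitness.behaviour E ρ σ
            (LOSRWitness.basisMeasurement ψ) (LOSRWitness.basisMeasurement φ)) >
          LOSRWitness.localMax ρ σ γ)) ∧
    -- the bound holds for every LOSR channel whatever (untrusted) measurements are performed
    (∀ (γ : α → β → X → Y → ℝ)
      (E : Matrix (A₀ × B₀) (A₀ × B₀) ℂ →ₗ[ℂ] Matrix (A₁ × B₁) (A₁ × B₁) ℂ)
      (M : α → Matrix (R × A₁) (R × A₁) ℂ) (N : β → Matrix (S × B₁) (S × B₁) ℂ),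
      LOSRWitness.IsLOSR E → LOSRWitness.IsPOVM M → LOSRWitness.IsPOVM N →
        LOSRWitness.value γ (LOSRWitness.behaviour E ρ σ M N) ≤
          LOSRWitness.localMax ρ σ γ) :=
  have ⟨hmax, hiff, hbound⟩ := mainTheorem4_general ρ σ (fun x => (hρ x).1.isHermitian)
    (fun y => (hσ y).1.isHermitian) hρ_span hσ_span ψ φ hψ hφ
  ⟨hmax, fun E hE => hiff E hE.1.isHermitianPreserving, hbound⟩
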